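/- Let ${\sf X}={\sf X}_{\sf u}\times{\sf X}_{\sf n}$ be a product of two finite sets, with elements $x=(x_u,x_n)$. Let $R_0(x,x_u')$ and $Q_0(x,x_n')$ be stochastic kernels from ${\sf X}$ to ${\sf X}_{\sf u}$ and to ${\sf X}_{\sf n}$, and suppose that the transition matrix $P_0(x,x')=R_0(x,x_u')Q_0(x,x_n')$ is irreducible and aperiodic (that is, for some $n_0\ge 1$, $P_0^n(x,x')>0$ for all $n\ge n_0$ and all $x,x'$). Let ${\cal U}\colon{\sf X}\to\mathbb{R}$, and fix a state $x^\circ\in{\sf X}$. Throughout, $R$ denotes a stochastic kernel from ${\sf X}$ to ${\sf X}_{\sf u}$, and $P(x,x')=R(x,x_u')Q_0(x,x_n')$. For $\zeta\in\mathbb{R}$ consider the problem $$\max_{\pi,R}\Bigl\{\zeta\sum_x\pi(x)\,{\cal U}(x)-K(P\|P_0)\ :\ \pi \text{ is a pmf on } {\sf X},\ \pi P=\pi\Bigr\},\qquad K(P\|P_0)=\sum_{x,x'}\pi(x)P(x,x')\log\frac{P(x,x')}{P_0(x,x')},$$ and the average reward optimality equation (AROE) for a function $h\colon{\sf X}\to\mathbb{R}$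 and a constant $\eta\in\mathbb{R}$: for every $x\in{\sf X}$, $$\max_R\Bigl\{\zeta\,{\cal U}(x)-\sum_{x'}P(x,x')\log\frac{P(x,x')}{P_0(x,x')}+\sum_{x'}P(x,x')h(x')\Bigr\}=h(x)+\eta .$$ Here the relative entropies use the convention $0\log 0=0$ and equal $+\infty$ when absolute continuity fails. Then there exist families $\{\check\pi_\zeta,\check P_\zeta,h^*_\zeta,\eta^*_\zeta:\zeta\in\mathbb{R}\}$ such that, for every $\zeta$, the pair $(\check\pi_\zeta,\check P_\zeta)$ is an optimizer of the first problem, $\eta^*_\zeta$ is its optimal value, the pair $(h^*_\zeta,\eta^*_\zeta)$ solves the AROE with $h^*_\zeta(x^\circ)=0$, and the following hold. (i) For all $\zeta$ and all $x,x'\in{\sf X}$, $$\check P_\zeta(x,x')=P_0(x,x')\exp\bigl(h_\zeta(x_u'\mid x)-\Lambda_{h_\zeta}(x)\bigr),$$ where $$h_\zeta(x_u'\mid x)=\sum_{x_n'\in{\sf X}_{\sf n}}Q_0(x,x_n')\,h^*_\zeta(x_u',x_n'),\qquad \Lambda_{h_\zeta}(x)=\log\Bigl(\sum_{x'}P_0(x,x')\exp\bigl(h_\zeta(x_u'\mid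 x)\bigr)\Bigr).$$ (ii) The quantities $\check\pi_\zeta(x)$, $\check P_\zeta(x,x')$, $h^*_\zeta(x)$ (for all $x,x'\in{\sf X}$) and $\eta^*_\zeta$ are continuously differentiable functions of $\zeta\in\mathbb{R}$. -/

import Mathlib

namespace KLMDP

/-- `R` is a stochastic kernel from `S` to `T`: every row is a pmf. -/
def IsStochastic {S T : Type*} [Fintype T] (R : S → T → ℝ) : Prop :=
  ∀ s, R s ∈ stdSimplex ℝ T

/-- The transition matrix `P(x, x') = R(x, x'_u) Q(x, x'_n)` on `Xu × Xn`. -/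
def joint {Xu Xn : Type*} (R : Xu × Xn → Xu → ℝ) (Q : Xu × Xn → Xn → ℝ) :
    Matrix (Xu × Xn) (Xu × Xn) ℝ :=
  fun x x' => R x x'.1 * Q x x'.2

/-- A transition matrix on a finite set is irreducible and aperiodic when all entries of all
sufficiently high powers are positive. -/
def IsIrreducibleAperiodic {X : Type*} [Fintype X] [DecidableEq X] (P : Matrix X X ℝ) : Prop :=
  ∃ n₀ : ℕ, 1 ≤ n₀ ∧ ∀ n : ℕ, n₀ ≤ n → ∀ x x' : X, 0 < (P ^ n) x x'

open Classical in
/-- Kullback–Leibler divergence of pmfs on a finite set, equal to `+∞` when `μ` is not absolutely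
continuous with respect to `ν`. -/
noncomputable def relEntropy {X : Type*} [Fintype X] (μ ν : X → ℝ) : EReal :=
  if ∀ x, ν x = 0 → μ x = 0 then
    ((∑ x, μ x * Real.log (μ x / ν x) : ℝ) : EReal)
  else ⊤

open Classical in
/-- Donsker–Varadhan rate `∑ π(x) P(x,x') log (P(x,x') / P₀(x,x'))`, equal to `+∞` when
`π(x) P(x,x')` is not absolutely continuous with respect to `π(x) P₀(x,x')`. -/
noncomputable def rate {X : Type*} [Fintype X] (π : X → ℝ) (P P₀ : Matrix X X ℝ) : EReal :=
  if ∀ x x', π x * P₀ x x' = 0 → π x * P x x' = 0 then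
    ((∑ x, ∑ x', π x * P x x' * Real.log (P x x' / P₀ x x') : ℝ) : EReal)
  else ⊤

/-- The objective `ζ π(U) - K(P ‖ P₀)`. -/
noncomputable def objective {X : Type*} [Fintype X] (P₀ : Matrix X X ℝ) (U : X → ℝ) (ζ : ℝ)
    (π : X → ℝ) (P : Matrix X X ℝ) : EReal :=
  ((ζ * ∑ x, π x * U x : ℝ) : EReal) - rate π P P₀

/-- The constraints: `π` is a pmf, `P = R Q₀` for some stochastic kernel `R`, and `π P = π`. -/
def Feasible {Xu Xn : Type*} [Fintype Xu] [Fintype Xn] (Q₀ : Xu × Xn → Xn → ℝ)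
    (π : Xu × Xn → ℝ) (P : Matrix (Xu × Xn) (Xu × Xn) ℝ) : Prop :=
  π ∈ stdSimplex ℝ (Xu × Xn) ∧
    (∃ R : Xu × Xn → Xu → ℝ, IsStochastic R ∧ P = joint R Q₀) ∧
    Matrix.vecMul π P = π

/-- `(π, P)` maximizes the objective, with nominal matrix `P₀ = R₀ Q₀`, under the constraints. -/
def IsOptimizer {Xu Xn : Type*} [Fintype Xu] [Fintype Xn] (R₀ : Xu × Xn → Xu → ℝ)
    (Q₀ : Xu × Xn → Xn → ℝ) (U : Xu × Xn → ℝ) (ζ : ℝ)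
    (π : Xu × Xn → ℝ) (P : Matrix (Xu × Xn) (Xu × Xn) ℝ) : Prop :=
  Feasible Q₀ π P ∧ ∀ π' P', Feasible Q₀ π' P' →
    objective (joint R₀ Q₀) U ζ π' P' ≤ objective (joint R₀ Q₀) U ζ π P

/-- One-step reward `w(x, R) = ζ U(x) - ∑ P(x,x') log (P(x,x') / P₀(x,x'))`, `P = R Q₀`. -/
noncomputable def reward {Xu Xn : Type*} [Fintype Xu] [Fintype Xn] (R₀ : Xu × Xn → Xu → ℝ)
    (Q₀ : Xu × Xn → Xn → ℝ) (U : Xu × Xn → ℝ) (ζ : ℝ)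
    (x : Xu × Xn) (R : Xu × Xn → Xu → ℝ) : EReal :=
  ((ζ * U x : ℝ) : EReal) - relEntropy (joint R Q₀ x) (joint R₀ Q₀ x)

/-- The average reward optimality equation: for every `x`,
`max_R { w(x, R) + ∑ P(x,x') h(x') } = h(x) + η`, the maximum being attained. -/
def SolvesAROE {Xu Xn : Type*} [Fintype Xu] [Fintype Xn] (R₀ : Xu × Xn → Xu → ℝ)
    (Q₀ : Xu × Xn → Xn → ℝ) (U : Xu × Xn → ℝ) (ζ : ℝ)
    (h : Xu × Xn → ℝ) (η : ℝ) : Prop :=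
  ∀ x, IsGreatest
    {v : EReal | ∃ R : Xu × Xn → Xu → ℝ, IsStochastic R ∧
      v = reward R₀ Q₀ U ζ x R + ((∑ x', joint R Q₀ x x' * h x' : ℝ) : EReal)}
    ((h x + η : ℝ) : EReal)

/-- `h(x'_u | x) = ∑_{x'_n} Q₀(x, x'_n) h(x'_u, x'_n)`. -/
noncomputable def condMean {Xu Xn : Type*} [Fintype Xn] (Q₀ : Xu × Xn → Xn → ℝ)
    (h : Xu × Xn → ℝ) (x : Xu × Xn) (xu' : Xu) : ℝ :=
  ∑ xn' : Xn, Q₀ x xn' * h (xu', xn')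

/-- The log normalizing constant `Λ_h(x) = log ∑ P₀(x,x') exp (h(x'_u | x))`. -/
noncomputable def logNorm {Xu Xn : Type*} [Fintype Xu] [Fintype Xn] (R₀ : Xu × Xn → Xu → ℝ)
    (Q₀ : Xu × Xn → Xn → ℝ) (h : Xu × Xn → ℝ) (x : Xu × Xn) : ℝ :=
  Real.log (∑ x', joint R₀ Q₀ x x' * Real.exp (condMean Q₀ h x x'.1))

end KLMDP

/-!
Write `h(x'_u | x)` for the conditional mean of `h` and `Λ_h(x)` for the log normalizing constant.
By the Gibbs variational formula (`gibbs_le`, `gibbs_eq`) the maximum in the optimality equation is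
`ζ U(x) + Λ_h(x)`, attained by the tilted kernel `R_h = R₀ exp (h(x'_u | x) - Λ_h(x))`. Hence the
equation is `ζ U + Λ_h = h + η`. Given a solution, averaging the Gibbs inequality against an
invariant pmf shows that `η` bounds the objective of every feasible pair, with equality for the
tilted matrix and its invariant pmf.

Encode `(h, η)` with `h(x₀) = 0` as the single function `v = h + η`. The optimality equation
becomes `F v = ζ U` with `F v = v - Λ_v + v(x₀)` (`aroeMap`), and everything follows from `F` being
a smooth diffeomorphism of `ℝ^X` (`exists_aroe_diffeo`):

* `v ↦ Λ_v(x)` is convex with gradient the row `P_v(x, ·)` of the tilted matrix, so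
  `DF(v) w = w - P_v w + w(x₀)` (`poissonOp`). The tilted matrix has the support of `P₀`, and the
  strong minimum principle makes both `F` and `DF(v)` injective.
* The inequality `P₀ v ≤ Λ_v` and positivity of a power of `P₀` bound the oscillation of `v`, and
  the minimum principle bounds `v(x₀)`. So `‖v‖ ≤ K ‖F v‖` and `F` is proper. Its range is then open
  and closed, and `F` is onto.

Thus `v` is a smooth function of `ζ`, and so are `h`, `η` and the tilted matrix. The invariant pmf
is the row at `x₀` of `DF(v)⁻¹`, that is, the gradient of `u ↦ (F⁻¹ u)(x₀)` at `u = ζ U`; it is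
`C¹` because `F⁻¹` is `C²`.
-/

namespace KLMDP

open Matrix

/-! ### The Gibbs variational formula on a finite set -/

section Gibbs

variable {X : Type*} [Fintype X] {p q f : X → ℝ}

/-- The tangent-line bound `log t ≤ t - 1`, in the form that sums to the Gibbs inequality. -/
theorem mul_sub_mul_log_div_le {a b : ℝ} (ha : 0 ≤ a) (hb : 0 ≤ b) (hab : b = 0 → a = 0) (t : ℝ) :
    a * t - a * Real.log (a / b) ≤ b * Real.exp t - a := by
  rcases ha.eq_or_lt with rfl | ha
  · simp only [zero_mul, sub_zero]
    positivity
  · have hb : 0 < b := hb.lt_of_ne fun h => ha.ne' (hab h.symm)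
    have h1 := Real.log_le_sub_one_of_pos (show 0 < b * Real.exp t / a by positivity)
    rw [Real.log_div (by positivity) ha.ne', Real.log_mul hb.ne' (Real.exp_pos t).ne',
      Real.log_exp] at h1
    rw [Real.log_div ha.ne' hb.ne']
    have h2 := mul_le_mul_of_nonneg_left h1 ha.le
    have h3 : a * (b * Real.exp t / a - 1) = b * Real.exp t - a := by field_simp
    linarith

theorem sum_mul_exp_pos (hq : q ∈ stdSimplex ℝ X) (f : X → ℝ) :
    0 < ∑ x, q x * Real.exp (f x) := by
  obtain ⟨x, hx⟩ : ∃ x, q x ≠ 0 := by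
    by_contra! h
    simpa [h] using hq.2
  exact Finset.sum_pos' (fun y _ => mul_nonneg (hq.1 y) (Real.exp_pos _).le)
    ⟨x, Finset.mem_univ x, mul_pos ((hq.1 x).lt_of_ne hx.symm) (Real.exp_pos _)⟩

theorem sum_mul_exp_sub_log (hq : q ∈ stdSimplex ℝ X) (f : X → ℝ) :
    ∑ x, q x * Real.exp (f x - Real.log (∑ y, q y * Real.exp (f y))) = 1 := by
  have hpos := sum_mul_exp_pos hq f
  simp only [Real.exp_sub, Real.exp_log hpos, ← mul_div_assoc]
  rw [← Finset.sum_div, div_self hpos.ne']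

/-- Donsker–Varadhan inequality: `∑ p f - D(p ‖ q) ≤ log ∑ q exp f` for `p` absolutely continuous
with respect to `q`. -/
theorem gibbs_le (hp : p ∈ stdSimplex ℝ X) (hq : q ∈ stdSimplex ℝ X)
    (hpq : ∀ x, q x = 0 → p x = 0) (f : X → ℝ) :
    ∑ x, p x * f x - ∑ x, p x * Real.log (p x / q x) ≤
      Real.log (∑ x, q x * Real.exp (f x)) := by
  set L := Real.log (∑ x, q x * Real.exp (f x)) with hL
  have key : ∑ x, (p x * (f x - L) - p x * Real.log (p x / q x)) ≤
      ∑ x, (q x * Real.exp (f x - L) - p x) :=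
    Finset.sum_le_sum fun x _ => mul_sub_mul_log_div_le (hp.1 x) (hq.1 x) (hpq x) _
  simp only [mul_sub, Finset.sum_sub_distrib] at key
  rw [← Finset.sum_mul, hp.2, hL, sum_mul_exp_sub_log hq f] at key
  linarith

/-- The exponentially tilted pmf attains equality in `gibbs_le`. -/
theorem gibbs_eq (hq : q ∈ stdSimplex ℝ X) (f : X → ℝ)
    (hp : ∀ x, p x = q x * Real.exp (f x - Real.log (∑ y, q y * Real.exp (f y)))) :
    ∑ x, p x * f x - ∑ x, p x * Real.log (p x / q x) =
      Real.log (∑ x, q x * Real.exp (f x)) := by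
  set L := Real.log (∑ x, q x * Real.exp (f x)) with hL
  have h1 : ∀ x, p x * Real.log (p x / q x) = p x * (f x - L) := by
    intro x
    by_cases hx : q x = 0
    · simp [hp x, hx]
    · rw [hp x, mul_div_cancel_left₀ _ hx, Real.log_exp]
  have h2 : ∑ x, p x = 1 := by
    simp only [hp]
    exact sum_mul_exp_sub_log hq f
  simp only [h1, mul_sub, Finset.sum_sub_distrib, ← Finset.sum_mul, h2]
  ring

end Gibbs

/-! ### Maximum principles and invariant vectors for stochastic matrices -/

section MaximumPrinciple

variable {X : Type*} [Fintype X] {P : Matrix X X ℝ}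

theorem IsStochastic.mulVec_sub_const (hP : IsStochastic P) (f : X → ℝ) (c : ℝ) (x : X) :
    ∑ y, P x y * (f y - c) = (P *ᵥ f) x - c := by
  simp only [mul_sub, Finset.sum_sub_distrib, ← Finset.sum_mul, (hP x).2, one_mul]
  rfl

theorem IsStochastic.mulVec_mono (hP : IsStochastic P) {f g : X → ℝ} (hfg : ∀ x, f x ≤ g x)
    (x : X) : (P *ᵥ f) x ≤ (P *ᵥ g) x :=
  Finset.sum_le_sum fun y _ => mul_le_mul_of_nonneg_left (hfg y) ((hP x).1 y)

/-- A set closed under the one-step transitions of `P` is closed under those of its powers. -/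
theorem pow_ne_zero_mem [DecidableEq X] {S : Set X}
    (hS : ∀ x y, x ∈ S → P x y ≠ 0 → y ∈ S) (n : ℕ) :
    ∀ {x y : X}, x ∈ S → (P ^ n) x y ≠ 0 → y ∈ S := by
  induction n with
  | zero =>
    intro x y hx h
    rw [pow_zero] at h
    by_cases hxy : x = y
    · exact hxy ▸ hx
    · exact absurd (Matrix.one_apply_ne hxy) h
  | succ n ih =>
    intro x y hx h
    rw [pow_succ, Matrix.mul_apply] at h
    obtain ⟨z, -, hz⟩ := Finset.exists_ne_zero_of_sum_ne_zero h
    exact hS z y (ih hx (left_ne_zero_of_mul hz)) (right_ne_zero_of_mul hz)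

/-- Evaluating at a minimizer of `f` shows that a nearly superharmonic shift is not too
negative. -/
theorem neg_le_of_mulVec_le (hP : IsStochastic P) {f : X → ℝ} (x₀ : X) {C : ℝ}
    (hf : ∀ x, (P *ᵥ f) x ≤ f x + f x₀ + C) : -C ≤ f x₀ := by
  have : Nonempty X := ⟨x₀⟩
  obtain ⟨x, hx⟩ := Finite.exists_min f
  have h1 : 0 ≤ ∑ y, P x y * (f y - f x) :=
    Finset.sum_nonneg fun y _ => mul_nonneg ((hP x).1 y) (sub_nonneg.2 (hx y))
  rw [hP.mulVec_sub_const] at h1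
  linarith [hf x]

/-- Strong minimum principle. Irreducibility is only needed for some matrix `P₀` whose support is
contained in that of `P`. -/
theorem eq_of_mulVec_le [DecidableEq X] {P₀ : Matrix X X ℝ} (hP₀ : IsIrreducibleAperiodic P₀)
    (hP : IsStochastic P) (hsupp : ∀ x y, P x y = 0 → P₀ x y = 0) {f : X → ℝ}
    (hf : ∀ x, (P *ᵥ f) x ≤ f x) (a b : X) : f a = f b := by
  have : Nonempty X := ⟨a⟩
  obtain ⟨x, hx⟩ := Finite.exists_min f
  obtain ⟨n, -, hn⟩ := hP₀
  have hclosed : ∀ y z, y ∈ {y | f y = f x} → P₀ y z ≠ 0 → z ∈ {y | f y = f x} := by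
    intro y z hy hyz
    have h0 : ∀ z ∈ Finset.univ, 0 ≤ P y z * (f z - f x) := fun z _ =>
      mul_nonneg ((hP y).1 z) (sub_nonneg.2 (hx z))
    have h1 : ∑ z, P y z * (f z - f x) ≤ 0 := by
      rw [hP.mulVec_sub_const]
      have : f y = f x := hy
      linarith [hf y]
    have h2 := (Finset.sum_eq_zero_iff_of_nonneg h0).1 (h1.antisymm (Finset.sum_nonneg h0)) z
      (Finset.mem_univ z)
    exact sub_eq_zero.1 ((mul_eq_zero.1 h2).resolve_left fun h => hyz (hsupp y z h))
  have hall : ∀ y, f y = f x := fun y =>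
    pow_ne_zero_mem (S := {y | f y = f x}) hclosed n rfl (hn n le_rfl x y).ne'
  rw [hall a, hall b]

theorem pow_mulVec_le [DecidableEq X] (hP : IsStochastic P) {f : X → ℝ} {C : ℝ}
    (hf : ∀ x, (P *ᵥ f) x ≤ f x + C) (n : ℕ) (x : X) : ((P ^ n) *ᵥ f) x ≤ f x + n * C := by
  induction n generalizing x with
  | zero => simp
  | succ n ih =>
    rw [pow_succ', ← Matrix.mulVec_mulVec]
    have h1 := hP.mulVec_mono ih x
    have h2 := hP.mulVec_sub_const f (-(n * C)) x
    simp only [sub_neg_eq_add] at h2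
    have h3 : (P *ᵥ fun x => f x + n * C) x = (P *ᵥ f) x + n * C := h2
    push_cast
    linarith [hf x]

theorem isStochastic_pow [DecidableEq X] (hP : IsStochastic P) (n : ℕ) :
    IsStochastic (P ^ n) := by
  induction n with
  | zero =>
    intro x
    rw [pow_zero]
    refine ⟨fun y => ?_, by simp [Matrix.one_apply]⟩
    rw [Matrix.one_apply]
    split_ifs <;> norm_num
  | succ n ih =>
    intro x
    rw [pow_succ]
    refine ⟨fun y => Finset.sum_nonneg fun z _ => mul_nonneg ((ih x).1 z) ((hP z).1 y), ?_⟩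
    simp only [Matrix.mul_apply]
    rw [Finset.sum_comm]
    simp only [← Finset.mul_sum, (hP _).2, mul_one, (ih x).2]

/-- The oscillation of a nearly superharmonic function is controlled by its defect. -/
theorem exists_osc_bound [DecidableEq X] (hP : IsStochastic P) (hirr : IsIrreducibleAperiodic P) :
    ∃ K : ℝ, 0 ≤ K ∧ ∀ (f : X → ℝ) (C : ℝ), 0 ≤ C → (∀ x, (P *ᵥ f) x ≤ f x + C) →
      ∀ x y, f y ≤ f x + K * C := by
  rcases isEmpty_or_nonempty X with hX | hX
  · exact ⟨0, le_rfl, fun _ _ _ _ x => hX.elim x⟩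
  obtain ⟨n, -, hn⟩ := hirr
  obtain ⟨⟨a, b⟩, hab⟩ := Finite.exists_min fun z : X × X => (P ^ n) z.1 z.2
  have hδ : 0 < (P ^ n) a b := hn n le_rfl a b
  refine ⟨n / (P ^ n) a b, by positivity, fun f C _ hf x y => ?_⟩
  obtain ⟨m, hm⟩ := Finite.exists_min f
  have h1 : ∑ z, (P ^ n) m z * (f z - f m) ≤ n * C := by
    rw [(isStochastic_pow hP n).mulVec_sub_const]
    linarith [pow_mulVec_le hP hf n m]
  have h2 : (P ^ n) m y * (f y - f m) ≤ ∑ z, (P ^ n) m z * (f z - f m) :=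
    Finset.single_le_sum (f := fun z => (P ^ n) m z * (f z - f m))
      (fun z _ => mul_nonneg (hn n le_rfl m z).le (sub_nonneg.2 (hm z))) (Finset.mem_univ y)
  have h3 : (P ^ n) a b * (f y - f m) ≤ n * C :=
    (mul_le_mul_of_nonneg_right (hab (m, y)) (sub_nonneg.2 (hm y))).trans (h2.trans h1)
  have h4 : f y - f m ≤ n / (P ^ n) a b * C := by
    rw [div_mul_eq_mul_div, le_div_iff₀ hδ]
    linarith
  linarith [hm x]

theorem vecMul_abs_eq (hP : IsStochastic P) {π : X → ℝ} (hπ : π ᵥ* P = π) :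
    |π| ᵥ* P = |π| := by
  -- `|π| ≤ |π| P` pointwise, and both sides have the same total mass.
  have hle : ∀ y ∈ Finset.univ, |π| y ≤ (|π| ᵥ* P) y := by
    intro y _
    calc |π| y = |∑ x, π x * P x y| := by
          rw [Pi.abs_apply, ← congrFun hπ y]; rfl
      _ ≤ ∑ x, |π x * P x y| := Finset.abs_sum_le_sum_abs _ _
      _ = (|π| ᵥ* P) y := Finset.sum_congr rfl fun x _ => by
          rw [abs_mul, abs_of_nonneg ((hP x).1 y), Pi.abs_apply]
  have hsum : ∑ y, |π| y = ∑ y, (|π| ᵥ* P) y := by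
    simp only [Matrix.vecMul, dotProduct]
    rw [Finset.sum_comm]
    simp only [← Finset.mul_sum, (hP _).2, mul_one]
  funext y
  exact ((Finset.sum_eq_sum_iff_of_le hle).1 hsum y (Finset.mem_univ y)).symm

/-- The operator `w ↦ w - P w + w(x₀) 1`. The term `w(x₀) 1` makes the Poisson operator `1 - P`,
whose kernel is the constants, invertible. -/
noncomputable def poissonOp (P : Matrix X X ℝ) (x₀ : X) : (X → ℝ) →ₗ[ℝ] (X → ℝ) where
  toFun w x := w x - (P *ᵥ w) x + w x₀
  map_add' v w := by
    funext x
    simp only [Matrix.mulVec_add, Pi.add_apply]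
    ring
  map_smul' c w := by
    funext x
    simp only [Matrix.mulVec_smul, Pi.smul_apply, smul_eq_mul, RingHom.id_apply]
    ring

theorem poissonOp_apply (P : Matrix X X ℝ) (x₀ : X) (w : X → ℝ) (x : X) :
    poissonOp P x₀ w x = w x - (P *ᵥ w) x + w x₀ := rfl

theorem poissonOp_injective [DecidableEq X] {P₀ : Matrix X X ℝ}
    (hP₀ : IsIrreducibleAperiodic P₀) (hP : IsStochastic P)
    (hsupp : ∀ x y, P x y = 0 → P₀ x y = 0) (x₀ : X) :
    Function.Injective (poissonOp P x₀) := by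
  rw [injective_iff_map_eq_zero]
  intro w hw
  have hw' : ∀ x, w x - (P *ᵥ w) x + w x₀ = 0 := fun x => congrFun hw x
  have h1 : -0 ≤ w x₀ := neg_le_of_mulVec_le hP x₀ fun x => by linarith [hw' x]
  have h2 : -0 ≤ (-w) x₀ := neg_le_of_mulVec_le hP x₀ fun x => by
    rw [Matrix.mulVec_neg]
    simp only [Pi.neg_apply]
    linarith [hw' x]
  have h3 : w x₀ = 0 := by
    simp only [Pi.neg_apply] at h2
    linarith
  funext x
  rw [eq_of_mulVec_le hP₀ hP hsupp (f := w) (fun x => by linarith [hw' x]) x x₀, h3]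
  rfl

/-- The row of `(poissonOp P x₀)⁻¹` at `x₀` is an invariant pmf of `P`. -/
theorem invariant_of_dotProduct_poissonOp (hP : IsStochastic P) {x₀ : X}
    (hsurj : Function.Surjective (poissonOp P x₀)) {π : X → ℝ}
    (hπ : ∀ w, π ⬝ᵥ poissonOp P x₀ w = w x₀) : π ∈ stdSimplex ℝ X ∧ π ᵥ* P = π := by
  classical
  have hdot : ∀ ρ w : X → ℝ, ρ ⬝ᵥ poissonOp P x₀ w =
      ρ ⬝ᵥ w - (ρ ᵥ* P) ⬝ᵥ w + (∑ x, ρ x) * w x₀ := by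
    intro ρ w
    rw [← Matrix.dotProduct_mulVec]
    simp only [dotProduct, poissonOp_apply, Finset.sum_mul, ← Finset.sum_sub_distrib,
      ← Finset.sum_add_distrib]
    exact Finset.sum_congr rfl fun x _ => by ring
  have hone : poissonOp P x₀ 1 = 1 := by
    funext x
    have : (P *ᵥ 1) x = 1 := by simpa [Matrix.mulVec, dotProduct] using (hP x).2
    rw [poissonOp_apply, this]
    simp
  have hsum : ∑ x, π x = 1 := by
    have := hπ 1
    rw [hone] at this
    simpa [dotProduct] using this
  have hinv : π ᵥ* P = π := by
    funext x
    have h1 := hπ (Pi.single x 1)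
    rw [hdot, hsum] at h1
    simp only [dotProduct_single, mul_one, one_mul] at h1
    linarith
  refine ⟨⟨fun x => ?_, hsum⟩, hinv⟩
  -- The measure `|π|` is invariant as well, hence a multiple of `π`.
  have habs : ∀ x, |π| x = (∑ y, |π| y) * π x := by
    intro x
    obtain ⟨w, hw⟩ := hsurj (Pi.single x 1)
    have h1 := hdot |π| w
    have h2 := hπ w
    rw [hw] at h1 h2
    rw [vecMul_abs_eq hP hinv, ← h2] at h1
    simpa [dotProduct_single] using h1
  have hmass : 0 < ∑ y, |π| y := by
    have := Finset.abs_sum_le_sum_abs π Finset.univ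
    rw [hsum, abs_one] at this
    exact one_pos.trans_le this
  have h1 : 0 ≤ (∑ y, |π| y) * π x := habs x ▸ abs_nonneg (π x)
  exact nonneg_of_mul_nonneg_right h1 hmass

end MaximumPrinciple

/-! ### Tilted kernels -/

section Tilt

theorem condMean_sub_const {Xu Xn : Type*} [Fintype Xn] {Q₀ : Xu × Xn → Xn → ℝ}
    (hQ : IsStochastic Q₀) (h : Xu × Xn → ℝ) (c : ℝ)
    (x : Xu × Xn) (u : Xu) : condMean Q₀ (fun y => h y - c) x u = condMean Q₀ h x u - c := by
  simp only [condMean, mul_sub, Finset.sum_sub_distrib, ← Finset.sum_mul, (hQ x).2, one_mul]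

variable {Xu Xn : Type*} [Fintype Xu] [Fintype Xn]
  {R₀ : Xu × Xn → Xu → ℝ} {Q₀ : Xu × Xn → Xn → ℝ}

theorem isStochastic_joint {R : Xu × Xn → Xu → ℝ} (hR : IsStochastic R) (hQ : IsStochastic Q₀) :
    IsStochastic (joint R Q₀) := by
  refine fun x => ⟨fun y => mul_nonneg ((hR x).1 _) ((hQ x).1 _), ?_⟩
  simp only [joint, Fintype.sum_prod_type, ← Finset.mul_sum, (hQ x).2, mul_one, (hR x).2]

theorem sum_joint_fst (hQ : IsStochastic Q₀) (R : Xu × Xn → Xu → ℝ) (x : Xu × Xn) (f : Xu → ℝ) :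
    ∑ x', joint R Q₀ x x' * f x'.1 = ∑ u, R x u * f u := by
  simp only [joint, Fintype.sum_prod_type]
  refine Finset.sum_congr rfl fun u _ => ?_
  rw [← Finset.sum_mul, ← Finset.mul_sum, (hQ x).2, mul_one]

/-- Averaging the conditional mean over the controlled coordinate averages `h`. -/
theorem sum_joint_condMean (hQ : IsStochastic Q₀) (R : Xu × Xn → Xu → ℝ) (h : Xu × Xn → ℝ)
    (x : Xu × Xn) :
    ∑ x', joint R Q₀ x x' * condMean Q₀ h x x'.1 = ∑ x', joint R Q₀ x x' * h x' := by
  rw [sum_joint_fst hQ R x (condMean Q₀ h x)]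
  simp only [joint, condMean, Fintype.sum_prod_type, Finset.mul_sum, mul_assoc]

/-- The kernel `R₀` tilted by `exp (h(x'_u | x))` and normalized. -/
noncomputable def tiltKernel (R₀ : Xu × Xn → Xu → ℝ) (Q₀ : Xu × Xn → Xn → ℝ) (h : Xu × Xn → ℝ) :
    Xu × Xn → Xu → ℝ :=
  fun x u => R₀ x u * Real.exp (condMean Q₀ h x u - logNorm R₀ Q₀ h x)

theorem joint_tiltKernel (h : Xu × Xn → ℝ) (x x' : Xu × Xn) :
    joint (tiltKernel R₀ Q₀ h) Q₀ x x' =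
      joint R₀ Q₀ x x' * Real.exp (condMean Q₀ h x x'.1 - logNorm R₀ Q₀ h x) := by
  simp only [joint, tiltKernel]
  ring

theorem isStochastic_tiltKernel (hR : IsStochastic R₀) (hQ : IsStochastic Q₀)
    (h : Xu × Xn → ℝ) : IsStochastic (tiltKernel R₀ Q₀ h) := by
  refine fun x => ⟨fun u => mul_nonneg ((hR x).1 u) (Real.exp_pos _).le, ?_⟩
  simp only [tiltKernel]
  rw [← sum_joint_fst hQ R₀ x fun u => Real.exp (condMean Q₀ h x u - logNorm R₀ Q₀ h x)]
  exact sum_mul_exp_sub_log (isStochastic_joint hR hQ x) fun x' => condMean Q₀ h x x'.1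

theorem joint_eq_zero_of_joint_tiltKernel {h : Xu × Xn → ℝ} {x x' : Xu × Xn}
    (h0 : joint (tiltKernel R₀ Q₀ h) Q₀ x x' = 0) : joint R₀ Q₀ x x' = 0 := by
  rw [joint_tiltKernel] at h0
  exact (mul_eq_zero.1 h0).resolve_right (Real.exp_pos _).ne'

theorem joint_tiltKernel_eq_zero {h : Xu × Xn → ℝ} {x x' : Xu × Xn}
    (h0 : joint R₀ Q₀ x x' = 0) : joint (tiltKernel R₀ Q₀ h) Q₀ x x' = 0 := by
  rw [joint_tiltKernel, h0, zero_mul]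

/-- The one-step reward without the utility, plus `P h`, is at most `Λ_h(x)`. -/
theorem sub_entropy_le_logNorm (hR₀ : IsStochastic R₀) (hQ : IsStochastic Q₀)
    {R : Xu × Xn → Xu → ℝ} (hR : IsStochastic R) {x : Xu × Xn}
    (hac : ∀ x', joint R₀ Q₀ x x' = 0 → joint R Q₀ x x' = 0) (h : Xu × Xn → ℝ) :
    (joint R Q₀ *ᵥ h) x - ∑ x', joint R Q₀ x x' * Real.log (joint R Q₀ x x' / joint R₀ Q₀ x x') ≤
      logNorm R₀ Q₀ h x := by
  have := gibbs_le (isStochastic_joint hR hQ x) (isStochastic_joint hR₀ hQ x) hac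
    fun x' => condMean Q₀ h x x'.1
  rwa [sum_joint_condMean hQ] at this

/-- The tilted kernel attains equality in `sub_entropy_le_logNorm`. -/
theorem sub_entropy_tiltKernel (hR₀ : IsStochastic R₀) (hQ : IsStochastic Q₀)
    (h : Xu × Xn → ℝ) (x : Xu × Xn) :
    (joint (tiltKernel R₀ Q₀ h) Q₀ *ᵥ h) x - ∑ x', joint (tiltKernel R₀ Q₀ h) Q₀ x x' *
      Real.log (joint (tiltKernel R₀ Q₀ h) Q₀ x x' / joint R₀ Q₀ x x') = logNorm R₀ Q₀ h x := by
  have := gibbs_eq (isStochastic_joint hR₀ hQ x) (fun x' => condMean Q₀ h x x'.1)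
    (joint_tiltKernel (R₀ := R₀) h x)
  rwa [sum_joint_condMean hQ] at this

/-- Convexity of `h ↦ Λ_h(x)`: the graph lies above its tangents, whose slope at `g` is the
transition matrix tilted by `g`. -/
theorem mulVec_sub_le_logNorm_sub (hR₀ : IsStochastic R₀) (hQ : IsStochastic Q₀)
    (h g : Xu × Xn → ℝ) (x : Xu × Xn) :
    (joint (tiltKernel R₀ Q₀ g) Q₀ *ᵥ (h - g)) x ≤ logNorm R₀ Q₀ h x - logNorm R₀ Q₀ g x := by
  have h1 := sub_entropy_le_logNorm hR₀ hQ (isStochastic_tiltKernel hR₀ hQ g) (x := x)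
    (fun x' => joint_tiltKernel_eq_zero) h
  have h2 := sub_entropy_tiltKernel hR₀ hQ g x
  rw [Matrix.mulVec_sub, Pi.sub_apply]
  linarith

theorem logNorm_zero (hR₀ : IsStochastic R₀) (hQ : IsStochastic Q₀) (x : Xu × Xn) :
    logNorm R₀ Q₀ 0 x = 0 := by
  simp [logNorm, condMean, (isStochastic_joint hR₀ hQ x).2]

theorem tiltKernel_zero (hR₀ : IsStochastic R₀) (hQ : IsStochastic Q₀) :
    tiltKernel R₀ Q₀ 0 = R₀ := by
  funext x u
  rw [tiltKernel, logNorm_zero hR₀ hQ]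
  simp [condMean]

theorem logNorm_sub_const (hR₀ : IsStochastic R₀) (hQ : IsStochastic Q₀) (h : Xu × Xn → ℝ)
    (c : ℝ) (x : Xu × Xn) :
    logNorm R₀ Q₀ (fun y => h y - c) x = logNorm R₀ Q₀ h x - c := by
  simp only [logNorm, condMean_sub_const hQ, Real.exp_sub, ← mul_div_assoc]
  rw [← Finset.sum_div, Real.log_div (sum_mul_exp_pos (isStochastic_joint hR₀ hQ x)
    fun x' => condMean Q₀ h x x'.1).ne' (Real.exp_pos c).ne', Real.log_exp]

theorem contDiff_condMean {n : WithTop ℕ∞} (x : Xu × Xn) (u : Xu) :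
    ContDiff ℝ n fun h : Xu × Xn → ℝ => condMean Q₀ h x u := by
  unfold condMean
  fun_prop

theorem contDiff_logNorm {n : WithTop ℕ∞} (hR₀ : IsStochastic R₀) (hQ : IsStochastic Q₀)
    (x : Xu × Xn) : ContDiff ℝ n fun h : Xu × Xn → ℝ => logNorm R₀ Q₀ h x := by
  unfold logNorm
  refine ContDiff.log (ContDiff.sum fun x' _ => contDiff_const.mul (contDiff_condMean x x'.1).exp)
    fun h => (sum_mul_exp_pos (isStochastic_joint hR₀ hQ x) fun x' => condMean Q₀ h x x'.1).ne'

/-- The gradient of `h ↦ Λ_h(x)` is the row of the tilted transition matrix at `x`. -/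
theorem hasDerivAt_logNorm (hR₀ : IsStochastic R₀) (hQ : IsStochastic Q₀)
    (h w : Xu × Xn → ℝ) (x : Xu × Xn) :
    HasDerivAt (fun t : ℝ => logNorm R₀ Q₀ (h + t • w) x)
      ((joint (tiltKernel R₀ Q₀ h) Q₀ *ᵥ w) x) 0 := by
  have hpos := sum_mul_exp_pos (isStochastic_joint hR₀ hQ x) fun x' => condMean Q₀ h x x'.1
  have hlin : ∀ (t : ℝ) u,
      condMean Q₀ (h + t • w) x u = condMean Q₀ h x u + t * condMean Q₀ w x u := by
    intro t u
    simp only [condMean, Finset.mul_sum, ← Finset.sum_add_distrib, Pi.add_apply, Pi.smul_apply,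
      smul_eq_mul]
    exact Finset.sum_congr rfl fun _ _ => by ring
  have hS : HasDerivAt (fun t : ℝ => ∑ x', joint R₀ Q₀ x x' *
      Real.exp (condMean Q₀ h x x'.1 + t * condMean Q₀ w x x'.1))
      (∑ x', joint R₀ Q₀ x x' * (Real.exp (condMean Q₀ h x x'.1) * condMean Q₀ w x x'.1)) 0 := by
    refine HasDerivAt.fun_sum fun x' _ => HasDerivAt.const_mul _ ?_
    have h1 : HasDerivAt (fun t : ℝ => condMean Q₀ h x x'.1 + t * condMean Q₀ w x x'.1)
        (condMean Q₀ w x x'.1) 0 := by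
      simpa using ((hasDerivAt_id (0 : ℝ)).mul_const (condMean Q₀ w x x'.1)).const_add
        (condMean Q₀ h x x'.1)
    simpa using h1.exp
  have hL := hS.log (by simpa using hpos.ne')
  simp only [logNorm, hlin]
  convert hL using 1
  have h1 : (joint (tiltKernel R₀ Q₀ h) Q₀ *ᵥ w) x = ∑ x', joint (tiltKernel R₀ Q₀ h) Q₀ x x' *
      condMean Q₀ w x x'.1 := (sum_joint_condMean hQ _ w x).symm
  rw [h1, Finset.sum_div]
  refine Finset.sum_congr rfl fun x' _ => ?_
  have h2 : Real.exp (logNorm R₀ Q₀ h x) = ∑ x', joint R₀ Q₀ x x' *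
      Real.exp (condMean Q₀ h x x'.1) := Real.exp_log hpos
  simp only [joint_tiltKernel, Real.exp_sub, h2, zero_mul, add_zero]
  ring

end Tilt

/-! ### The optimality equation as a global diffeomorphism -/

section Poisson

variable {Xu Xn : Type*} [Fintype Xu] [Fintype Xn]
  {R₀ : Xu × Xn → Xu → ℝ} {Q₀ : Xu × Xn → Xn → ℝ}

/-- The map `v ↦ v - Λ_v + v(x₀) 1`. Under `h = v - v(x₀)`, `η = v(x₀)`, the equation
`aroeMap R₀ Q₀ x₀ v = ζ U` is `ζ U + Λ_h = h + η`. -/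
noncomputable def aroeMap (R₀ : Xu × Xn → Xu → ℝ) (Q₀ : Xu × Xn → Xn → ℝ) (x₀ : Xu × Xn)
    (v : Xu × Xn → ℝ) : Xu × Xn → ℝ :=
  fun x => v x - logNorm R₀ Q₀ v x + v x₀

theorem contDiff_aroeMap {n : WithTop ℕ∞} (hR₀ : IsStochastic R₀) (hQ : IsStochastic Q₀)
    (x₀ : Xu × Xn) : ContDiff ℝ n (aroeMap R₀ Q₀ x₀) := by
  refine contDiff_pi.2 fun x => ?_
  exact ((contDiff_apply ℝ ℝ x).sub (contDiff_logNorm hR₀ hQ x)).add (contDiff_apply ℝ ℝ x₀)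

theorem fderiv_aroeMap_apply (hR₀ : IsStochastic R₀) (hQ : IsStochastic Q₀) (x₀ : Xu × Xn)
    (v w : Xu × Xn → ℝ) :
    fderiv ℝ (aroeMap R₀ Q₀ x₀) v w =
      poissonOp (joint (tiltKernel R₀ Q₀ v) Q₀) x₀ w := by
  have hd := ((contDiff_aroeMap (n := 1) hR₀ hQ x₀).differentiable one_ne_zero v).hasFDerivAt
  have h1 : HasDerivAt (fun t : ℝ => v + t • w) w 0 := by
    simpa using ((hasDerivAt_id (0 : ℝ)).smul_const w).const_add v
  have h2 := HasFDerivAt.comp_hasDerivAt_of_eq (0 : ℝ) hd h1 (by simp)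
  refine h2.unique (hasDerivAt_pi.2 fun x => ?_)
  have h3 : ∀ y, HasDerivAt (fun t : ℝ => (v + t • w) y) (w y) 0 := hasDerivAt_pi.1 h1
  exact ((h3 x).sub (hasDerivAt_logNorm hR₀ hQ v w x)).add (h3 x₀)

variable [DecidableEq Xu] [DecidableEq Xn]

/-- Convexity of `Λ` makes the difference of two preimages nearly superharmonic for a tilted matrix,
and the minimum principle applies to it. -/
theorem aroeMap_injective (hR₀ : IsStochastic R₀) (hQ : IsStochastic Q₀)
    (hP₀ : IsIrreducibleAperiodic (joint R₀ Q₀)) (x₀ : Xu × Xn) :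
    Function.Injective (aroeMap R₀ Q₀ x₀) := by
  have key : ∀ v v', aroeMap R₀ Q₀ x₀ v = aroeMap R₀ Q₀ x₀ v' → ∀ x,
      (joint (tiltKernel R₀ Q₀ v') Q₀ *ᵥ (v - v')) x ≤ (v - v') x + (v - v') x₀ := by
    intro v v' h x
    have h1 := congrFun h x
    simp only [aroeMap] at h1
    have h2 := mulVec_sub_le_logNorm_sub hR₀ hQ v v' x
    simp only [Pi.sub_apply]
    linarith
  have hst : ∀ v, IsStochastic (joint (tiltKernel R₀ Q₀ v) Q₀) := fun v =>
    isStochastic_joint (isStochastic_tiltKernel hR₀ hQ v) hQ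
  have hnn : ∀ v v', aroeMap R₀ Q₀ x₀ v = aroeMap R₀ Q₀ x₀ v' → 0 ≤ (v - v') x₀ := by
    intro v v' h
    simpa using neg_le_of_mulVec_le (hst v') x₀ (C := 0) (f := v - v')
      fun x => by simpa using key v v' h x
  intro v v' h
  have h0 : (v - v') x₀ = 0 := by
    have h1 := hnn v v' h
    have h2 := hnn v' v h.symm
    simp only [Pi.sub_apply] at *
    linarith
  funext x
  have h1 := eq_of_mulVec_le hP₀ (hst v') (fun x y => joint_eq_zero_of_joint_tiltKernel)
    (f := v - v') (fun x => by linarith [key v v' h x]) x x₀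
  rw [h0, Pi.sub_apply] at h1
  linarith

/-- A priori bound for the optimality equation. -/
theorem exists_norm_le_aroeMap (hR₀ : IsStochastic R₀) (hQ : IsStochastic Q₀)
    (hP₀ : IsIrreducibleAperiodic (joint R₀ Q₀)) (x₀ : Xu × Xn) :
    ∃ K : ℝ, 0 < K ∧ ∀ v, ‖v‖ ≤ K * ‖aroeMap R₀ Q₀ x₀ v‖ := by
  obtain ⟨K, hK, hosc⟩ := exists_osc_bound (isStochastic_joint hR₀ hQ) hP₀
  refine ⟨1 + K * 2, by positivity, fun v => ?_⟩
  set C := ‖aroeMap R₀ Q₀ x₀ v‖ with hC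
  have hC0 : 0 ≤ C := norm_nonneg _
  have hu : ∀ x, |v x - logNorm R₀ Q₀ v x + v x₀| ≤ C := fun x =>
    norm_le_pi_norm (aroeMap R₀ Q₀ x₀ v) x
  have hlow : ∀ x, (joint R₀ Q₀ *ᵥ v) x ≤ v x + v x₀ + C := by
    intro x
    have h1 := mulVec_sub_le_logNorm_sub hR₀ hQ v 0 x
    rw [logNorm_zero hR₀ hQ, tiltKernel_zero hR₀ hQ, sub_zero, sub_zero] at h1
    linarith [(abs_le.1 (hu x)).2, (abs_le.1 (hu x)).1]
  have h1 : -C ≤ v x₀ := neg_le_of_mulVec_le (isStochastic_joint hR₀ hQ) x₀ hlow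
  have h2 : -C ≤ (-v) x₀ := by
    refine neg_le_of_mulVec_le
      (isStochastic_joint (isStochastic_tiltKernel hR₀ hQ v) hQ) x₀ fun x => ?_
    have h3 := mulVec_sub_le_logNorm_sub hR₀ hQ 0 v x
    rw [logNorm_zero hR₀ hQ, zero_sub, zero_sub] at h3
    simp only [Pi.neg_apply]
    linarith [(abs_le.1 (hu x)).2, (abs_le.1 (hu x)).1]
  simp only [Pi.neg_apply] at h2
  -- `v x₀ ≤ C` turns `hlow` into near superharmonicity with defect `2 * C`.
  have h3 := hosc v (2 * C) (by positivity) fun x => by linarith [hlow x]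
  refine (pi_norm_le_iff_of_nonneg (by positivity)).2 fun y => ?_
  rw [Real.norm_eq_abs, abs_le]
  constructor <;> linarith [h3 x₀ y, h3 y x₀]

/-- `aroeMap` is a homeomorphism with `C²` inverse, and the derivative of the inverse inverts
`poissonOp` of the tilted matrix. -/
theorem exists_aroe_diffeo (hR₀ : IsStochastic R₀) (hQ : IsStochastic Q₀)
    (hP₀ : IsIrreducibleAperiodic (joint R₀ Q₀)) (x₀ : Xu × Xn) :
    ∃ Φ : (Xu × Xn → ℝ) ≃ₜ (Xu × Xn → ℝ), ⇑Φ = aroeMap R₀ Q₀ x₀ ∧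
      ContDiff ℝ 2 Φ.symm ∧ ∀ u, Function.Surjective
        (poissonOp (joint (tiltKernel R₀ Q₀ (Φ.symm u)) Q₀) x₀) ∧
        ∀ w, fderiv ℝ Φ.symm u
          (poissonOp (joint (tiltKernel R₀ Q₀ (Φ.symm u)) Q₀) x₀ w) = w := by
  have hinj : ∀ v, Function.Injective (poissonOp (joint (tiltKernel R₀ Q₀ v) Q₀) x₀) := fun v =>
    poissonOp_injective hP₀ (isStochastic_joint (isStochastic_tiltKernel hR₀ hQ v) hQ)
      (fun x y => joint_eq_zero_of_joint_tiltKernel) x₀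
  have hsm : ContDiff ℝ 2 (aroeMap R₀ Q₀ x₀) := contDiff_aroeMap hR₀ hQ x₀
  let A : (Xu × Xn → ℝ) → (Xu × Xn → ℝ) ≃L[ℝ] (Xu × Xn → ℝ) := fun v =>
    (LinearEquiv.ofInjectiveEndo _ (hinj v)).toContinuousLinearEquiv
  have hA : ∀ v, fderiv ℝ (aroeMap R₀ Q₀ x₀) v = A v := fun v =>
    ContinuousLinearMap.ext fun w => fderiv_aroeMap_apply hR₀ hQ x₀ v w
  have hstrict : ∀ v, HasStrictFDerivAt (aroeMap R₀ Q₀ x₀)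
      (A v : (Xu × Xn → ℝ) →L[ℝ] (Xu × Xn → ℝ)) v := fun v =>
    hA v ▸ hsm.contDiffAt.hasStrictFDerivAt two_ne_zero
  have hopen : IsOpenMap (aroeMap R₀ Q₀ x₀) := isOpenMap_of_hasStrictFDerivAt_equiv hstrict
  have hproper : IsProperMap (aroeMap R₀ Q₀ x₀) := by
    rw [isProperMap_iff_tendsto_cocompact]
    refine ⟨hsm.continuous, ?_⟩
    obtain ⟨K, hK, hbound⟩ := exists_norm_le_aroeMap hR₀ hQ hP₀ x₀
    rw [← Metric.cobounded_eq_cocompact, ← tendsto_norm_atTop_iff_cobounded]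
    refine Filter.tendsto_atTop_mono (fun v => ?_)
      ((tendsto_norm_cobounded_atTop (E := Xu × Xn → ℝ)).const_mul_atTop (inv_pos.2 hK))
    rw [inv_mul_le_iff₀ hK]
    exact hbound v
  -- The range is open, closed and nonempty.
  have hsurj : Function.Surjective (aroeMap R₀ Q₀ x₀) := by
    rw [← Set.range_eq_univ]
    exact IsClopen.eq_univ ⟨hproper.isClosedMap.isClosed_range, hopen.isOpen_range⟩
      (Set.range_nonempty _)
  let Φ : (Xu × Xn → ℝ) ≃ₜ (Xu × Xn → ℝ) := Equiv.toHomeomorphOfContinuousOpen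
    (Equiv.ofBijective _ ⟨aroeMap_injective hR₀ hQ hP₀ x₀, hsurj⟩) hsm.continuous hopen
  have hΦ : ∀ v, HasFDerivAt Φ (A v : (Xu × Xn → ℝ) →L[ℝ] (Xu × Xn → ℝ)) v := fun v =>
    (hstrict v).hasFDerivAt
  refine ⟨Φ, rfl, Φ.contDiff_symm hΦ hsm, fun u =>
    ⟨LinearMap.surjective_of_injective (hinj _), fun w => ?_⟩⟩
  have h1 : HasFDerivAt Φ.symm ((A (Φ.symm u)).symm : (Xu × Xn → ℝ) →L[ℝ] (Xu × Xn → ℝ)) u :=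
    HasFDerivAt.of_local_left_inverse Φ.symm.continuous.continuousAt (hΦ _)
      (Filter.Eventually.of_forall Φ.apply_symm_apply)
  rw [h1.fderiv]
  exact (A (Φ.symm u)).symm_apply_apply w

end Poisson

/-! ### Verification of optimality -/

section Verification

variable {Xu Xn : Type*} [Fintype Xu] [Fintype Xn]
  {R₀ : Xu × Xn → Xu → ℝ} {Q₀ : Xu × Xn → Xn → ℝ} {U : Xu × Xn → ℝ} {ζ : ℝ}
  {h : Xu × Xn → ℝ} {η : ℝ}

theorem solvesAROE_of_logNorm (hR₀ : IsStochastic R₀) (hQ : IsStochastic Q₀)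
    (heq : ∀ x, ζ * U x + logNorm R₀ Q₀ h x = h x + η) : SolvesAROE R₀ Q₀ U ζ h η := by
  intro x
  constructor
  · refine ⟨tiltKernel R₀ Q₀ h, isStochastic_tiltKernel hR₀ hQ h, ?_⟩
    rw [reward, relEntropy, if_pos fun x' => joint_tiltKernel_eq_zero, ← EReal.coe_sub,
      ← EReal.coe_add, EReal.coe_eq_coe_iff, ← heq x, ← sub_entropy_tiltKernel hR₀ hQ h x]
    simp only [Matrix.mulVec, dotProduct]
    ring
  · rintro _ ⟨R, hR, rfl⟩
    rw [reward, relEntropy]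
    split_ifs with hac
    · rw [← EReal.coe_sub, ← EReal.coe_add, EReal.coe_le_coe_iff]
      have := sub_entropy_le_logNorm hR₀ hQ hR hac h
      simp only [Matrix.mulVec, dotProduct] at this
      linarith [heq x]
    · rw [EReal.sub_top, EReal.bot_add]
      exact bot_le

/-- Averaging a function and its one-step mean against an invariant law gives the same value. -/
theorem sum_mul_mulVec_of_invariant {X : Type*} [Fintype X] {P : Matrix X X ℝ} {π : X → ℝ}
    (hπ : π ᵥ* P = π) (f : X → ℝ) : ∑ x, π x * (P *ᵥ f) x = ∑ x, π x * f x := by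
  have := Matrix.dotProduct_mulVec π P f
  rwa [hπ] at this

/-- A solution of the optimality equation bounds the objective of all feasible pairs. -/
theorem objective_le_of_logNorm (hR₀ : IsStochastic R₀) (hQ : IsStochastic Q₀)
    (heq : ∀ x, ζ * U x + logNorm R₀ Q₀ h x = h x + η) {π : Xu × Xn → ℝ}
    {P : Matrix (Xu × Xn) (Xu × Xn) ℝ} (hfeas : Feasible Q₀ π P) :
    objective (joint R₀ Q₀) U ζ π P ≤ (η : EReal) := by
  obtain ⟨hπ, ⟨R, hR, rfl⟩, hinv⟩ := hfeas
  rw [objective, rate]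
  split_ifs with hac
  · rw [← EReal.coe_sub, EReal.coe_le_coe_iff]
    have hx : ∀ x ∈ Finset.univ, π x * (ζ * U x) - ∑ x', π x * joint R Q₀ x x' *
        Real.log (joint R Q₀ x x' / joint R₀ Q₀ x x') + π x * (joint R Q₀ *ᵥ h) x ≤
        π x * h x + π x * η := by
      intro x _
      by_cases h0 : π x = 0
      · simp [h0]
      · have h1 := sub_entropy_le_logNorm hR₀ hQ hR (x := x) (fun x' hx' =>
          (mul_eq_zero.1 (hac x x' (by rw [hx', mul_zero]))).resolve_left h0) h
        have h2 := mul_le_mul_of_nonneg_left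
          (show ζ * U x - ∑ x', joint R Q₀ x x' *
            Real.log (joint R Q₀ x x' / joint R₀ Q₀ x x') + (joint R Q₀ *ᵥ h) x ≤ h x + η by
              linarith [heq x]) (hπ.1 x)
        simp only [mul_assoc, ← Finset.mul_sum]
        linarith
    have hsum := Finset.sum_le_sum hx
    simp only [Finset.sum_add_distrib, Finset.sum_sub_distrib, ← Finset.sum_mul, hπ.2, one_mul]
      at hsum
    rw [sum_mul_mulVec_of_invariant hinv] at hsum
    have h3 : ζ * ∑ x, π x * U x = ∑ x, π x * (ζ * U x) := by
      rw [Finset.mul_sum]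
      exact Finset.sum_congr rfl fun x _ => by ring
    linarith
  · rw [EReal.sub_top]
    exact bot_le

/-- The bound `objective_le_of_logNorm` is attained by the tilted matrix with an invariant pmf. -/
theorem objective_tiltKernel (hR₀ : IsStochastic R₀) (hQ : IsStochastic Q₀)
    (heq : ∀ x, ζ * U x + logNorm R₀ Q₀ h x = h x + η) {π : Xu × Xn → ℝ}
    (hπ : π ∈ stdSimplex ℝ (Xu × Xn)) (hinv : π ᵥ* joint (tiltKernel R₀ Q₀ h) Q₀ = π) :
    objective (joint R₀ Q₀) U ζ π (joint (tiltKernel R₀ Q₀ h) Q₀) = (η : EReal) := by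
  rw [objective, rate, if_pos fun x x' h0 => ?_]
  · rw [← EReal.coe_sub, EReal.coe_eq_coe_iff]
    have hx : ∀ x, ∑ x', π x * joint (tiltKernel R₀ Q₀ h) Q₀ x x' *
        Real.log (joint (tiltKernel R₀ Q₀ h) Q₀ x x' / joint R₀ Q₀ x x') =
        π x * (joint (tiltKernel R₀ Q₀ h) Q₀ *ᵥ h) x - π x * h x - π x * η +
          ζ * (π x * U x) := by
      intro x
      simp only [mul_assoc, ← Finset.mul_sum]
      have h1 := sub_entropy_tiltKernel hR₀ hQ h x
      have h2 := heq x
      linear_combination (-π x) * h1 - π x * h2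
    simp only [hx, Finset.sum_add_distrib, Finset.sum_sub_distrib, ← Finset.sum_mul, hπ.2,
      one_mul, ← Finset.mul_sum]
    rw [sum_mul_mulVec_of_invariant hinv]
    ring
  · rcases mul_eq_zero.1 h0 with h0 | h0
    · rw [h0, zero_mul]
    · rw [joint_tiltKernel_eq_zero h0, mul_zero]

end Verification

end KLMDP

theorem theoremt {Xu Xn : Type*} [Fintype Xu] [DecidableEq Xu] [Fintype Xn] [DecidableEq Xn]
    (R₀ : Xu × Xn → Xu → ℝ) (Q₀ : Xu × Xn → Xn → ℝ)
    (hR₀ : KLMDP.IsStochastic R₀) (hQ₀ : KLMDP.IsStochastic Q₀)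
    (hP₀ : KLMDP.IsIrreducibleAperiodic (KLMDP.joint R₀ Q₀))
    (U : Xu × Xn → ℝ) (x₀ : Xu × Xn) :
    ∃ (π : ℝ → Xu × Xn → ℝ) (P : ℝ → Matrix (Xu × Xn) (Xu × Xn) ℝ)
      (h : ℝ → Xu × Xn → ℝ) (η : ℝ → ℝ),
      (∀ ζ : ℝ,
        KLMDP.IsOptimizer R₀ Q₀ U ζ (π ζ) (P ζ) ∧
        ((η ζ : ℝ) : EReal) = KLMDP.objective (KLMDP.joint R₀ Q₀) U ζ (π ζ) (P ζ) ∧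
        KLMDP.SolvesAROE R₀ Q₀ U ζ (h ζ) (η ζ) ∧
        h ζ x₀ = 0 ∧
        ∀ x x', P ζ x x' = KLMDP.joint R₀ Q₀ x x' *
          Real.exp (KLMDP.condMean Q₀ (h ζ) x x'.1 - KLMDP.logNorm R₀ Q₀ (h ζ) x)) ∧
      (∀ x, ContDiff ℝ 1 (fun ζ => π ζ x)) ∧
      (∀ x x', ContDiff ℝ 1 (fun ζ => P ζ x x')) ∧
      (∀ x, ContDiff ℝ 1 (fun ζ => h ζ x)) ∧
      ContDiff ℝ 1 η := by
  obtain ⟨Φ, hΦ, hsm, hD⟩ := KLMDP.exists_aroe_diffeo hR₀ hQ₀ hP₀ x₀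
  -- `v ζ` encodes `h = v ζ - v ζ x₀` and `η = v ζ x₀`.
  set v : ℝ → Xu × Xn → ℝ := fun ζ => Φ.symm (ζ • U) with hv
  have hline : ContDiff ℝ 2 fun ζ : ℝ => ζ • U := contDiff_id.smul contDiff_const
  have hvsm : ContDiff ℝ 1 v := (hsm.comp hline).of_le one_le_two
  have hvx : ∀ x, ContDiff ℝ 1 fun ζ => v ζ x := fun x => contDiff_pi.1 hvsm x
  have heq : ∀ ζ x, v ζ x - KLMDP.logNorm R₀ Q₀ (v ζ) x + v ζ x₀ = ζ * U x := fun ζ x => by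
    have h1 : KLMDP.aroeMap R₀ Q₀ x₀ (v ζ) = ζ • U := by
      rw [← hΦ]
      exact Φ.apply_symm_apply _
    exact congrFun h1 x
  set h : ℝ → Xu × Xn → ℝ := fun ζ y => v ζ y - v ζ x₀ with hh
  have htilt : ∀ ζ, KLMDP.tiltKernel R₀ Q₀ (h ζ) = KLMDP.tiltKernel R₀ Q₀ (v ζ) := fun ζ => by
    funext x u
    simp only [KLMDP.tiltKernel, hh, KLMDP.condMean_sub_const hQ₀,
      KLMDP.logNorm_sub_const hR₀ hQ₀, sub_sub_sub_cancel_right]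
  have haroe : ∀ ζ x, ζ * U x + KLMDP.logNorm R₀ Q₀ (h ζ) x = h ζ x + v ζ x₀ := fun ζ x => by
    rw [hh, KLMDP.logNorm_sub_const hR₀ hQ₀]
    linarith [heq ζ x]
  -- The gradient of the optimal value with respect to the utility is the optimal invariant law.
  set π : ℝ → Xu × Xn → ℝ := fun ζ x => fderiv ℝ Φ.symm (ζ • U) (Pi.single x 1) x₀ with hπdef
  have hπ : ∀ ζ, π ζ ∈ stdSimplex ℝ (Xu × Xn) ∧
      Matrix.vecMul (π ζ) (KLMDP.joint (KLMDP.tiltKernel R₀ Q₀ (h ζ)) Q₀) = π ζ := fun ζ => by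
    rw [htilt]
    refine KLMDP.invariant_of_dotProduct_poissonOp
      (KLMDP.isStochastic_joint (KLMDP.isStochastic_tiltKernel hR₀ hQ₀ _) hQ₀)
      (hD (ζ • U)).1 fun w => ?_
    have h1 : ∀ z : Xu × Xn → ℝ, dotProduct (π ζ) z = fderiv ℝ Φ.symm (ζ • U) z x₀ := fun z => by
      conv_rhs => rw [pi_eq_sum_univ' z]
      simp only [map_sum, map_smul, Finset.sum_apply, Pi.smul_apply, smul_eq_mul, dotProduct,
        hπdef, mul_comm]
    rw [h1]
    exact congrFun ((hD (ζ • U)).2 w) x₀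
  have hfeas : ∀ ζ, KLMDP.Feasible Q₀ (π ζ) (KLMDP.joint (KLMDP.tiltKernel R₀ Q₀ (h ζ)) Q₀) :=
    fun ζ => ⟨(hπ ζ).1, ⟨_, KLMDP.isStochastic_tiltKernel hR₀ hQ₀ _, rfl⟩, (hπ ζ).2⟩
  have hval : ∀ ζ, KLMDP.objective (KLMDP.joint R₀ Q₀) U ζ (π ζ)
      (KLMDP.joint (KLMDP.tiltKernel R₀ Q₀ (h ζ)) Q₀) = (v ζ x₀ : EReal) := fun ζ =>
    KLMDP.objective_tiltKernel hR₀ hQ₀ (haroe ζ) (hπ ζ).1 (hπ ζ).2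
  have hhx : ∀ x, ContDiff ℝ 1 fun ζ => h ζ x := fun x => (hvx x).sub (hvx x₀)
  have hhsm : ContDiff ℝ 1 h := contDiff_pi.2 hhx
  refine ⟨π, fun ζ => KLMDP.joint (KLMDP.tiltKernel R₀ Q₀ (h ζ)) Q₀, h, fun ζ => v ζ x₀,
    fun ζ => ⟨⟨hfeas ζ, fun π' P' hf => ?_⟩, (hval ζ).symm,
      KLMDP.solvesAROE_of_logNorm hR₀ hQ₀ (haroe ζ), sub_self _,
      KLMDP.joint_tiltKernel (h ζ)⟩, fun x => ?_, fun x x' => ?_, hhx, hvx x₀⟩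
  · rw [hval]
    exact KLMDP.objective_le_of_logNorm hR₀ hQ₀ (haroe ζ) hf
  · have h1 : ContDiff ℝ 1 (fderiv ℝ Φ.symm) := hsm.fderiv_right (by norm_num)
    have h2 : ContDiff ℝ 1 fun ζ : ℝ => fderiv ℝ Φ.symm (ζ • U) (Pi.single x 1) :=
      (h1.comp (hline.of_le one_le_two)).clm_apply contDiff_const
    exact contDiff_pi.1 h2 x₀
  · simp only [KLMDP.joint_tiltKernel]
    exact contDiff_const.mul ((((KLMDP.contDiff_condMean x x'.1).comp hhsm).sub
      ((KLMDP.contDiff_logNorm hR₀ hQ₀ x).comp hhsm)).exp)
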